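/- Let $\mathsf N\ge 0$ be an integer, $\eta\in\mathbb C\setminus\{0\}$, $\mathcal H=\bigotimes_{n=1}^{\mathsf N}V_n$ with $V_n\simeq\mathbb C^2$, and let $$R(\lambda)=\begin{pmatrix}\lambda+\eta&0&0&0\\0&\lambda&\eta&0\\0&\eta&\lambda&0\\0&0&0&\lambda+\eta\end{pmatrix}$$ be the rational 6-vertex $R$-matrix on $\mathbb C^2\otimes\mathbb C^2$. For $\zeta\in\mathbb C\setminus\{0\}$ and $\kappa,\tau\in\mathbb C$ put $$K(\lambda;\zeta,\kappa,\tau)=\frac1\zeta\begin{pmatrix}\zeta+\lambda-\eta/2&2\kappa e^{\tau}(\lambda-\eta/2)\\2\kappa e^{-\tau}(\lambda-\eta/2)&\zeta-\lambda+\eta/2\end{pmatrix},$$ and let $K(\lambda;\infty,\kappa,\tau)=I$ be its limit $\zeta\to\infty$. Given boundary parameters $\zeta_\pm,\kappa_\pm,\tau_\pm$, let $K_-(\lambda)=K(\lambda;\zeta_-,\kappa_-,\tau_-)$ and $K_+(\lambda)=K(\lambda+\eta;\zeta_+,\kappa_+,\tau_+)$. For inhomogeneities $\xi=(\xi_1,\dots,\xi_{\mathsf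 N})\in\mathbb C^{\mathsf N}$ set $$M_0(\lambda)=R_{0\mathsf N}(\lambda-\xi_{\mathsf N}-\eta/2)\cdots R_{01}(\lambda-\xi_1-\eta/2),\qquad \hat M_0(\lambda)=(-1)^{\mathsf N}\sigma_0^y\,M_0^{t_0}(-\lambda)\,\sigma_0^y,$$ where $0$ labels an auxiliary space $\mathbb C^2$ and $t_0$ is transposition in that space, and $$T(\lambda)=\mathrm{tr}_0\{K_+(\lambda)M_0(\lambda)K_-(\lambda)\hat M_0(\lambda)\}\in\mathrm{End}(\mathcal H).$$ Let $\bar\zeta_\pm=\zeta_\pm$ if $\kappa_\pm^2=-1/4$ and $\bar\zeta_\pm=\epsilon_\pm\zeta_\pm/\sqrt{1+4\kappa_\pm^2}$ otherwise, with any choice of signs $\epsilon_\pm\in\{1,-1\}$, let $a(\lambda)=\prod_{n=1}^{\mathsf N}(\lambda-\xi_n+\eta/2)$, $d(\lambda)=\prod_{n=1}^{\mathsf N}(\lambda-\xi_n-\eta/2)$, and $$\mathsf A(\lambda)=(-1)^{\mathsf N}\,\frac{2\lambda+\eta}{2\lambda}\,\frac{(\lambda-\frac\eta2+\bar\zeta_+)(\lambda-\frac\eta2+\bar\zeta_-)}{\bar\zeta_+\bar\zeta_-}\,a(\lambda)\,d(-\lambda),$$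 where the factor $(\lambda-\frac\eta2+\bar\zeta_\pm)/\bar\zeta_\pm$ is read as $1$ if $\zeta_\pm=\infty$. Call $\xi$ admissible if $\xi_a\ne\xi_b+\epsilon\eta$ for all $a\ne b$ and all $\epsilon\in\{-1,0,1\}$. For a co-vector $\langle S|\in\mathcal H^*$ and $h=(h_1,\dots,h_{\mathsf N})\in\{0,1\}^{\mathsf N}$ define $$\langle h_1,\dots,h_{\mathsf N}|=\langle S|\prod_{n=1}^{\mathsf N}\left(\frac{T(\xi_n-\eta/2)}{\mathsf A(\eta/2-\xi_n)}\right)^{1-h_n}\in\mathcal H^*.\qquad(*)$$ Below, "for almost every" choice of some parameters means: for all values of these parameters, taken jointly, off the zero set of some nonzero polynomial in them (a co-vector $\langle S|$ being parametrized by its components). i) Suppose that $K_+$ and $K_-$ are non-commuting, i.e. $\zeta_\pm\in\mathbb C\setminus\{0\}$ and $\kappa_-e^{a\tau_-}\ne\kappa_+e^{a\tau_+}$ for some $a\in\{-1,1\}$. Then the family $(*)$, $h\in\{0,1\}^{\mathsf N}$, is a basis of $\mathcal H^*$ for almost every co-vector $\langle S|$ and almost every admissible $\xi$. ii) Suppose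 that the boundary matrices commute, with $\kappa_-e^{\pm\tau_-}=\kappa_+e^{\pm\tau_+}$ for both signs, and are not both proportional to the identity. Then, for every fixed $\zeta_+\in(\mathbb C\setminus\{0\})\cup\{\infty\}$ (and fixed $\kappa_\pm,\tau_\pm$), the family $(*)$ is a basis of $\mathcal H^*$ for almost every co-vector $\langle S|$, almost every admissible $\xi$ and almost every $\zeta_-\in\mathbb C\setminus\{0\}$. The same holds with the roles of $\zeta_+$ and $\zeta_-$ exchanged. (For a finite value of $\zeta_\pm$ the matrix $K_\pm$ is never proportional to the identity.) -/

import Mathlib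

open scoped OnePoint

noncomputable section

namespace ReflAlg

/-- Labels of the natural basis of `⊗_{n=1}^N ℂ²` (`0` is spin up, `1` is spin down). -/
abbrev Config (N : ℕ) : Type := Fin N → Fin 2

/-- The quantum space `⊗_{n=1}^N ℂ²`, in coordinates with respect to its natural basis. -/
abbrev QSpace (N : ℕ) : Type := Config N → ℂ

/-- Endomorphisms of the quantum space, as matrices in the natural basis. -/
abbrev Op (N : ℕ) : Type := Matrix (Config N) (Config N) ℂ

/-- Endomorphisms of `V_0 ⊗ H`, as `2 × 2` matrices over the auxiliary space `V_0 = ℂ²` whose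
entries are operators on the quantum space `H`. -/
abbrev AuxOp (N : ℕ) : Type := Matrix (Fin 2) (Fin 2) (Op N)

/-- The rational 6-vertex `R`-matrix on `ℂ² ⊗ ℂ²`; the pair `(i, j)` labels `e_i ⊗ e_j` and the
pairs are listed in the order `(0,0), (0,1), (1,0), (1,1)`. -/
def Rmat (η lam : ℂ) : Matrix (Fin 2 × Fin 2) (Fin 2 × Fin 2) ℂ :=
  (!![lam + η, 0, 0, 0;
      0, lam, η, 0;
      0, η, lam, 0;
      0, 0, 0, lam + η] : Matrix (Fin 4) (Fin 4) ℂ).submatrix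
    (finProdFinEquiv : Fin 2 × Fin 2 ≃ Fin (2 * 2))
    (finProdFinEquiv : Fin 2 × Fin 2 ≃ Fin (2 * 2))

/-- The boundary matrix with parameters `ζ, κ, τ`. The value `ζ = ∞` stands for the limit
`ζ → ∞`, in which the boundary matrix is the identity. -/
def Kmat (η : ℂ) (ζ : OnePoint ℂ) (κ τ lam : ℂ) : Matrix (Fin 2) (Fin 2) ℂ :=
  ζ.elim 1 fun z =>
    (1 / z) • !![z + lam - η / 2, 2 * κ * Complex.exp τ * (lam - η / 2);
                 2 * κ * Complex.exp (-τ) * (lam - η / 2), z - lam + η / 2]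

/-- `K_-(λ)`. -/
def Kminus (η : ℂ) (ζ : OnePoint ℂ) (κ τ lam : ℂ) : Matrix (Fin 2) (Fin 2) ℂ :=
  Kmat η ζ κ τ lam

/-- `K_+(λ)`, which is `K_-(λ + η)` taken at the parameters of the other boundary. -/
def Kplus (η : ℂ) (ζ : OnePoint ℂ) (κ τ lam : ℂ) : Matrix (Fin 2) (Fin 2) ℂ :=
  Kmat η ζ κ τ (lam + η)

/-- The operator on the quantum space that acts as `X` on the site `n` and as the identity on
all other sites. -/
def siteOp {N : ℕ} (n : Fin N) (X : Matrix (Fin 2) (Fin 2) ℂ) : Op N :=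
  Matrix.of fun s t => if ∀ m, m ≠ n → s m = t m then X (s n) (t n) else 0

/-- A scalar matrix acting on the auxiliary space only. -/
def onAux (N : ℕ) (X : Matrix (Fin 2) (Fin 2) ℂ) : AuxOp N :=
  X.map fun c => c • (1 : Op N)

/-- `R_{0n}(λ)`: the `R`-matrix acting on the auxiliary space and on the site `n`. -/
def R0 (η : ℂ) {N : ℕ} (n : Fin N) (lam : ℂ) : AuxOp N :=
  Matrix.of fun i j => siteOp n (Matrix.of fun k l => Rmat η lam (i, k) (j, l))

/-- The bulk monodromy matrix `M_0(λ) = R_{0N}(λ - ξ_N - η/2) ⋯ R_{01}(λ - ξ_1 - η/2)`. -/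
def bulkMonodromy (η : ℂ) {N : ℕ} (ξ : Fin N → ℂ) (lam : ℂ) : AuxOp N :=
  (List.ofFn fun n : Fin N => R0 η n (lam - (ξ n + η / 2))).reverse.prod

/-- The Pauli matrix `σ^y`. -/
def sigmaY : Matrix (Fin 2) (Fin 2) ℂ := !![0, -Complex.I; Complex.I, 0]

/-- `M̂_0(λ) = (-1)^N σ_0^y M_0^{t_0}(-λ) σ_0^y`. The transpose is over the auxiliary space only:
`Matrix.transpose` exchanges the operator entries without transposing them. -/
def hatMonodromy (η : ℂ) {N : ℕ} (ξ : Fin N → ℂ) (lam : ℂ) : AuxOp N :=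
  ((-1 : ℂ) ^ N) •
    (onAux N sigmaY * (bulkMonodromy η ξ (-lam)).transpose * onAux N sigmaY)

/-- The boundary transfer matrix `T(λ) = tr_0 (K_+(λ) M(λ) K_-(λ) M̂(λ))`, for given functions
`K_+` and `K_-` of the spectral parameter. -/
def transferMatrix (η : ℂ) {N : ℕ} (Kp Km : ℂ → Matrix (Fin 2) (Fin 2) ℂ) (ξ : Fin N → ℂ)
    (lam : ℂ) : Op N :=
  (onAux N (Kp lam) * bulkMonodromy η ξ lam * onAux N (Km lam) * hatMonodromy η ξ lam).trace

/-- The parameter `ζ̄`: it is `ζ` if `κ² = -1/4`, and `ε ζ / √(1 + 4κ²)` otherwise, where the sign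
`ε` fixes the choice of the square root. It is `∞` for `ζ = ∞`. -/
def zetaBar (ε κ : ℂ) (ζ : OnePoint ℂ) : OnePoint ℂ :=
  ζ.map fun z => if κ ^ 2 = -1 / 4 then z else ε * z / (1 + 4 * κ ^ 2) ^ (1 / 2 : ℂ)

/-- `(λ - η/2 + ζ̄) / ζ̄`, which is `1` in the limit `ζ̄ = ∞`. -/
def boundaryFactor (η : ℂ) (ζb : OnePoint ℂ) (lam : ℂ) : ℂ :=
  ζb.elim 1 fun z => (lam - η / 2 + z) / z

/-- `a(λ) = ∏ₙ (λ - ξₙ + η/2)`. -/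
def aFun (η : ℂ) {N : ℕ} (ξ : Fin N → ℂ) (lam : ℂ) : ℂ := ∏ n, (lam - ξ n + η / 2)

/-- `d(λ) = ∏ₙ (λ - ξₙ - η/2)`. -/
def dFun (η : ℂ) {N : ℕ} (ξ : Fin N → ℂ) (lam : ℂ) : ℂ := ∏ n, (lam - ξ n - η / 2)

/-- The coefficient `A_{ζ̄₊,ζ̄₋}(λ)`. -/
def Acoef (η : ℂ) {N : ℕ} (ζbp ζbm : OnePoint ℂ) (ξ : Fin N → ℂ) (lam : ℂ) : ℂ :=
  (-1) ^ N * ((2 * lam + η) / (2 * lam)) *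
    (boundaryFactor η ζbp lam * boundaryFactor η ζbm lam) * aFun η ξ lam * dFun η ξ (-lam)

/-- The condition on the inhomogeneities: `ξ_a ≠ ξ_b + ε η` for `a ≠ b` and `ε ∈ {-1, 0, 1}`. -/
def Admissible (η : ℂ) {N : ℕ} (ξ : Fin N → ℂ) : Prop :=
  ∀ a b : Fin N, a ≠ b → ∀ ε : ℤ, ε ∈ ({-1, 0, 1} : Set ℤ) → ξ a ≠ ξ b + ε * η

/-- The co-vector `⟨h₁,…,h_N| = ⟨S| ∏_{n=1}^N (T(ξₙ - η/2) / A(η/2 - ξₙ))^{1 - hₙ}`, as an element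
of the dual of the quantum space. The product is taken in the order `n = 1, …, N`. -/
def sovCovector (η : ℂ) {N : ℕ} (T : ℂ → Op N) (A : ℂ → ℂ) (ξ : Fin N → ℂ)
    (S : Module.Dual ℂ (QSpace N)) (h : Fin N → Fin 2) : Module.Dual ℂ (QSpace N) :=
  S ∘ₗ Matrix.toLin' (List.ofFn fun n : Fin N =>
    ((A (η / 2 - ξ n))⁻¹ • T (ξ n - η / 2)) ^ (1 - (h n : ℕ))).prod

/-- The family of co-vectors `⟨h₁,…,h_N|`, `h ∈ {0,1}^N`, attached to the parameters `ζ_±, κ_±, τ_±`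
and the signs `ε_±`, is a basis of the dual of the quantum space. -/
def SovIsBasis (η : ℂ) {N : ℕ} (εp εm : ℂ) (ζp ζm : OnePoint ℂ) (κp τp κm τm : ℂ)
    (S : Module.Dual ℂ (QSpace N)) (ξ : Fin N → ℂ) : Prop :=
  ∃ b : Module.Basis (Fin N → Fin 2) ℂ (Module.Dual ℂ (QSpace N)), ∀ h,
    b h = sovCovector η (transferMatrix η (Kplus η ζp κp τp) (Kminus η ζm κm τm) ξ)
      (Acoef η (zetaBar εp κp ζp) (zetaBar εm κm ζm) ξ) ξ S h

/-- The components of a co-vector in the natural basis. -/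
def coords {N : ℕ} (S : Module.Dual ℂ (QSpace N)) : Config N → ℂ := fun s => S (Pi.single s 1)

/-- `Q S ξ` holds for almost every pair of a co-vector and a tuple of complex numbers, that is, off
the zero set of some nonzero polynomial in the components of `S` and in `ξ`. -/
def ForAlmostAll {N : ℕ} (Q : Module.Dual ℂ (QSpace N) → (Fin N → ℂ) → Prop) : Prop :=
  ∃ P : MvPolynomial (Config N ⊕ Fin N) ℂ, P ≠ 0 ∧
    ∀ S ξ, MvPolynomial.eval (Sum.elim (coords S) ξ) P ≠ 0 → Q S ξ

/-- The same for triples, with one more complex parameter. -/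
def ForAlmostAll₃ {N : ℕ} (Q : Module.Dual ℂ (QSpace N) → (Fin N → ℂ) → ℂ → Prop) : Prop :=
  ∃ P : MvPolynomial (Config N ⊕ Fin N ⊕ Unit) ℂ, P ≠ 0 ∧
    ∀ S ξ ζ, MvPolynomial.eval (Sum.elim (coords S) (Sum.elim ξ fun _ => ζ)) P ≠ 0 → Q S ξ ζ

end ReflAlg

end

/-!
Up to nonzero factors the boundary matrices, and with them the transfer matrix `T`, are polynomial
in all parameters. Hence the determinant of the components of the co-vectors `⟨h₁,…,h_N|`, with the
normalization by `A` removed (`sovMatrix`), is a polynomial, and `A` does not vanish at generic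
points (`eventually_Acoef_ne_zero`). It is therefore enough to find a single point where the
determinant is nonzero (`eventually_sovIsBasis`); that point need not be admissible.

The point is found far out in parameter space. Write `R_{0m}(λ) = λ + η P_{0m}` with the
permutation `P_{0m}` and put `ξ_m = y_m / t`, `λ = ξ_n - η/2`, `t → 0`. After rescaling, every
factor of `T(λ)` with `m ≠ n` tends to a scalar, and so does the whole of `M̂(λ)`, whereas
`R_{0n}(-η) = η (P_{0n} - 1)` for every `t`. So the rescaled `T(ξ_n - η/2)` tends to a nonzero
multiple of the one-site operator `K₋K₊ - tr(K₋K₊)` at the site `n`, where `K_±` now denote the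
limits of the rescaled boundary matrices (`tendsto_smul_transferMatrix`). If `K₋K₊` is not a
multiple of the identity, it has a cyclic co-vector on each site, and the tensor product of these
generates a basis (`det_sovMatrix_siteOp_ne_zero`); by continuity the determinant is nonzero for
some small `t ≠ 0` (`exists_det_sovMatrix_ne_zero`).

For fixed finite `ζ_±` the limits of the boundary matrices are multiples of the slopes
`boundarySlope`, and a product of two slopes is a multiple of the identity precisely when they are
equal. In the commuting case they are equal, and one lets the free parameter grow like `1 / t` as
well: the limit of its boundary matrix is then `1 + y G` with `G` the slope, while that of the
other is `y G` or `1`. The product is not a multiple of the identity, because `G²` is such a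
multiple and `G` is not.
-/

noncomputable section

open Filter Topology Matrix

namespace ReflAlg

/-! ### Polynomial maps and generic points -/

/-- The filter of generic points of affine space `ℂ^σ`: its members are the sets that contain the
complement of the zero set of some nonzero polynomial. -/
def generic (σ : Type*) : Filter (σ → ℂ) where
  sets := {U | ∃ P : MvPolynomial σ ℂ, P ≠ 0 ∧ ∀ x, MvPolynomial.eval x P ≠ 0 → x ∈ U}
  univ_sets := ⟨1, one_ne_zero, fun _ _ => trivial⟩
  sets_of_superset := fun ⟨P, hP, h⟩ hUV => ⟨P, hP, fun x hx => hUV (h x hx)⟩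
  inter_sets := fun ⟨P, hP, h⟩ ⟨Q, hQ, h'⟩ => ⟨P * Q, mul_ne_zero hP hQ, fun x hx => by
    rw [map_mul] at hx
    exact ⟨h x (left_ne_zero_of_mul hx), h' x (right_ne_zero_of_mul hx)⟩⟩

lemma eventually_generic {σ : Type*} {Q : (σ → ℂ) → Prop} :
    (∀ᶠ x in generic σ, Q x) ↔
      ∃ P : MvPolynomial σ ℂ, P ≠ 0 ∧ ∀ x, MvPolynomial.eval x P ≠ 0 → Q x :=
  Iff.rfl

/-- The polynomial maps from `ℂ^σ` to a complex vector space `V`: the linear combinations of the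
maps `x ↦ P(x) v` with a polynomial `P` and a vector `v`. -/
def polyMap (σ V : Type*) [AddCommGroup V] [Module ℂ V] : Submodule ℂ ((σ → ℂ) → V) :=
  Submodule.span ℂ {f | ∃ (P : MvPolynomial σ ℂ) (v : V), f = fun x => MvPolynomial.eval x P • v}

section polyMap

variable {σ V W A : Type*} [AddCommGroup V] [Module ℂ V] [AddCommGroup W] [Module ℂ W]
  [Ring A] [Algebra ℂ A]

lemma const_mem_polyMap (v : V) : (fun _ => v) ∈ polyMap σ V :=
  Submodule.subset_span ⟨1, v, by simp⟩

lemma coord_mem_polyMap (i : σ) : (fun x => x i) ∈ polyMap σ ℂ :=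
  Submodule.subset_span ⟨MvPolynomial.X i, 1, by simp⟩

lemma mem_polyMap_iff {f : (σ → ℂ) → ℂ} :
    f ∈ polyMap σ ℂ ↔ ∃ P : MvPolynomial σ ℂ, f = fun x => MvPolynomial.eval x P := by
  refine ⟨fun hf => ?_, fun ⟨P, hP⟩ => Submodule.subset_span ⟨P, 1, by simpa using hP⟩⟩
  induction hf using Submodule.span_induction with
  | mem f hf =>
    obtain ⟨P, v, rfl⟩ := hf
    exact ⟨P * MvPolynomial.C v, by simp⟩
  | zero => exact ⟨0, by ext; simp⟩
  | add f g _ _ hf hg =>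
    obtain ⟨P, rfl⟩ := hf
    obtain ⟨Q, rfl⟩ := hg
    exact ⟨P + Q, by ext; simp⟩
  | smul c f _ hf =>
    obtain ⟨P, rfl⟩ := hf
    exact ⟨MvPolynomial.C c * P, by ext; simp⟩

lemma linear_comp_mem_polyMap (L : V →ₗ[ℂ] W) {f : (σ → ℂ) → V} (hf : f ∈ polyMap σ V) :
    (fun x => L (f x)) ∈ polyMap σ W := by
  induction hf using Submodule.span_induction with
  | mem f hf =>
    obtain ⟨P, v, rfl⟩ := hf
    exact Submodule.subset_span ⟨P, L v, by ext; simp⟩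
  | zero => simpa using const_mem_polyMap (0 : W)
  | add f g _ _ hf hg =>
    simp only [Pi.add_apply, map_add]
    exact add_mem hf hg
  | smul c f _ hf =>
    simp only [Pi.smul_apply, map_smul]
    exact Submodule.smul_mem _ c hf

/-- A bilinear pairing of polynomial maps is a polynomial map. -/
lemma bilinear_mem_polyMap {U : Type*} [AddCommGroup U] [Module ℂ U] (B : V →ₗ[ℂ] W →ₗ[ℂ] U)
    {f : (σ → ℂ) → V} {g : (σ → ℂ) → W} (hf : f ∈ polyMap σ V) (hg : g ∈ polyMap σ W) :
    (fun x => B (f x) (g x)) ∈ polyMap σ U := by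
  induction hf using Submodule.span_induction with
  | mem f hf =>
    obtain ⟨P, v, rfl⟩ := hf
    induction hg using Submodule.span_induction with
    | mem g hg =>
      obtain ⟨Q, w, rfl⟩ := hg
      exact Submodule.subset_span ⟨Q * P, B v w, by
        ext x
        simp only [map_smul, LinearMap.smul_apply, map_mul, mul_smul]⟩
    | zero => simpa using const_mem_polyMap (0 : U)
    | add g g' _ _ hg hg' =>
      simp only [Pi.add_apply, map_add]
      exact add_mem hg hg'
    | smul c g _ hg =>
      simp only [Pi.smul_apply, map_smul _ c]
      exact Submodule.smul_mem _ c hg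
  | zero => simpa using const_mem_polyMap (0 : U)
  | add f f' _ _ hf hf' =>
    simp only [Pi.add_apply, map_add, LinearMap.add_apply]
    exact add_mem hf hf'
  | smul c f _ hf =>
    simp only [Pi.smul_apply, map_smul, LinearMap.smul_apply]
    exact Submodule.smul_mem _ c hf

lemma mul_mem_polyMap {f g : (σ → ℂ) → A} (hf : f ∈ polyMap σ A) (hg : g ∈ polyMap σ A) :
    (fun x => f x * g x) ∈ polyMap σ A :=
  bilinear_mem_polyMap (LinearMap.mul ℂ A) hf hg

lemma smul_mem_polyMap {f : (σ → ℂ) → ℂ} {g : (σ → ℂ) → V} (hf : f ∈ polyMap σ ℂ)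
    (hg : g ∈ polyMap σ V) : (fun x => f x • g x) ∈ polyMap σ V :=
  bilinear_mem_polyMap (LinearMap.lsmul ℂ V) hf hg

lemma pow_mem_polyMap {f : (σ → ℂ) → A} (hf : f ∈ polyMap σ A) (k : ℕ) :
    (fun x => f x ^ k) ∈ polyMap σ A := by
  induction k with
  | zero => simpa using const_mem_polyMap (1 : A)
  | succ k ih => simpa only [pow_succ] using mul_mem_polyMap ih hf

lemma list_prod_mem_polyMap {ι : Type*} {f : ι → (σ → ℂ) → A} (hf : ∀ i, f i ∈ polyMap σ A)
    (l : List ι) : (fun x => (l.map fun i => f i x).prod) ∈ polyMap σ A := by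
  induction l with
  | nil => simpa using const_mem_polyMap (1 : A)
  | cons i l ih => simpa using mul_mem_polyMap (hf i) ih

lemma det_mem_polyMap {n : Type*} [Fintype n] [DecidableEq n] {f : (σ → ℂ) → Matrix n n ℂ}
    (hf : ∀ i j, (fun x => f x i j) ∈ polyMap σ ℂ) : (fun x => (f x).det) ∈ polyMap σ ℂ := by
  choose P hP using fun i j => mem_polyMap_iff.1 (hf i j)
  refine mem_polyMap_iff.2 ⟨(Matrix.of P).det, funext fun x => ?_⟩
  rw [RingHom.map_det]
  congr 1
  ext i j
  exact congrFun (hP i j) x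

/-- A polynomial function that takes a nonzero value is nonzero at generic points. -/
lemma eventually_ne_zero_of_mem_polyMap {f : (σ → ℂ) → ℂ} (hf : f ∈ polyMap σ ℂ) (x₀ : σ → ℂ)
    (h : f x₀ ≠ 0) : ∀ᶠ x in generic σ, f x ≠ 0 := by
  obtain ⟨P, rfl⟩ := mem_polyMap_iff.1 hf
  exact eventually_generic.2 ⟨P, fun h0 => h (by simp [h0]), fun x hx => hx⟩

end polyMap

/-! ### The matrix of components of the separated co-vectors -/

/-- The matrix whose row `h` consists of the components of the co-vector
`v T_1^{1-h_1} ⋯ T_N^{1-h_N}`, where `v` is a row vector. -/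
def sovMatrix {N : ℕ} (v : Config N → ℂ) (T : Fin N → Op N) : Matrix (Config N) (Config N) ℂ :=
  Matrix.of fun h => v ᵥ* (List.ofFn fun n => T n ^ (1 - (h n : ℕ))).prod

lemma list_prod_map_smul {ι R A : Type*} [CommSemiring R] [Semiring A] [Algebra R A] (c : ι → R)
    (f : ι → A) (l : List ι) :
    (l.map fun i => c i • f i).prod = (l.map c).prod • (l.map f).prod := by
  induction l with
  | nil => simp
  | cons i l ih => simp [ih, mul_smul, smul_comm (c i)]

lemma list_prod_ofFn_smul_pow {N : ℕ} (c : Fin N → ℂ) (T : Fin N → Op N) (e : Fin N → ℕ) :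
    (List.ofFn fun n => (c n • T n) ^ e n).prod =
      (∏ n, c n ^ e n) • (List.ofFn fun n => T n ^ e n).prod := by
  simp_rw [smul_pow, List.ofFn_eq_map, list_prod_map_smul, ← List.ofFn_eq_map, List.prod_ofFn]

lemma det_sovMatrix_smul {N : ℕ} (v : Config N → ℂ) (c : Fin N → ℂ) (T : Fin N → Op N) :
    (sovMatrix v fun n => c n • T n).det =
      (∏ h : Config N, ∏ n, c n ^ (1 - (h n : ℕ))) * (sovMatrix v T).det := by
  rw [← Matrix.det_mul_column]
  congr 1
  ext h s
  simp [sovMatrix, list_prod_ofFn_smul_pow, Matrix.vecMul_smul]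

lemma coords_comp_toLin' {N : ℕ} (S : Module.Dual ℂ (QSpace N)) (M : Op N) :
    coords (S ∘ₗ Matrix.toLin' M) = coords S ᵥ* M := by
  ext t
  have h := LinearMap.pi_apply_eq_sum_univ S (M *ᵥ Pi.single t 1)
  simp only [coords, LinearMap.comp_apply, Matrix.toLin'_apply, Matrix.vecMul, dotProduct]
  rw [h]
  simp only [Matrix.mulVec_single_one, Matrix.col_apply, smul_eq_mul]
  refine Finset.sum_congr rfl fun s _ => ?_
  rw [mul_comm]
  congr 2
  ext j
  simp [Pi.single_apply, eq_comm]

lemma sovIsBasis_of_det_ne_zero {N : ℕ} {η εp εm : ℂ} {ζp ζm : OnePoint ℂ} {κp τp κm τm : ℂ}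
    {S : Module.Dual ℂ (QSpace N)} {ξ : Fin N → ℂ}
    (hA : ∀ n, Acoef η (zetaBar εp κp ζp) (zetaBar εm κm ζm) ξ (η / 2 - ξ n) ≠ 0)
    (hdet : (sovMatrix (coords S) fun n =>
      transferMatrix η (Kplus η ζp κp τp) (Kminus η ζm κm τm) ξ (ξ n - η / 2)).det ≠ 0) :
    SovIsBasis η εp εm ζp ζm κp τp κm τm S ξ := by
  set c : Fin N → ℂ := fun n =>
    (Acoef η (zetaBar εp κp ζp) (zetaBar εm κm ζm) ξ (η / 2 - ξ n))⁻¹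
  set F := sovCovector η (transferMatrix η (Kplus η ζp κp τp) (Kminus η ζm κm τm) ξ)
      (Acoef η (zetaBar εp κp ζp) (zetaBar εm κm ζm) ξ) ξ S with hF
  have hdet' : (sovMatrix (coords S) fun n => c n •
      transferMatrix η (Kplus η ζp κp τp) (Kminus η ζm κm τm) ξ (ξ n - η / 2)).det ≠ 0 := by
    rw [det_sovMatrix_smul]
    exact mul_ne_zero (Finset.prod_ne_zero_iff.2 fun h _ => Finset.prod_ne_zero_iff.2 fun n _ =>
      pow_ne_zero _ (inv_ne_zero (hA n))) hdet
  let L : Module.Dual ℂ (QSpace N) →ₗ[ℂ] (Config N → ℂ) :=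
    { toFun := coords, map_add' := fun _ _ => rfl, map_smul' := fun _ _ => rfl }
  have hli : LinearIndependent ℂ F := by
    refine LinearIndependent.of_comp L ?_
    have hLF : L ∘ F = fun h => (sovMatrix (coords S) fun n => c n •
        transferMatrix η (Kplus η ζp κp τp) (Kminus η ζm κm τm) ξ (ξ n - η / 2)) h :=
      funext fun h => coords_comp_toLin' S _
    rw [hLF]
    exact Matrix.linearIndependent_rows_of_det_ne_zero hdet'
  refine ⟨basisOfLinearIndependentOfCardEqFinrank hli ?_, fun h => ?_⟩
  · rw [Subspace.dual_finrank_eq, Module.finrank_fintype_fun_eq_card]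
  · simp [hF]

/-! ### One-site operators and product co-vectors -/

lemma siteOp_add {N : ℕ} (n : Fin N) (X Y : Matrix (Fin 2) (Fin 2) ℂ) :
    siteOp n (X + Y) = siteOp n X + siteOp n Y := by
  ext s t
  simp only [siteOp, Matrix.of_apply, Matrix.add_apply]
  split_ifs <;> simp

lemma siteOp_smul {N : ℕ} (n : Fin N) (c : ℂ) (X : Matrix (Fin 2) (Fin 2) ℂ) :
    siteOp n (c • X) = c • siteOp n X := by
  ext s t
  simp [siteOp]

lemma siteOp_one {N : ℕ} (n : Fin N) : siteOp n 1 = 1 := by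
  ext s t
  simp only [siteOp, Matrix.of_apply, Matrix.one_apply]
  by_cases h : s = t
  · simp [h]
  · rw [if_neg h]
    split_ifs with h1 h2
    · exact absurd (funext fun m => if hm : m = n then hm ▸ h2 else h1 m hm) h
    · rfl
    · rfl

/-- The row vector of components of the product co-vector `w_1 ⊗ ⋯ ⊗ w_N`. -/
def productVec {N : ℕ} (w : Fin N → Fin 2 → ℂ) : Config N → ℂ := fun s => ∏ n, w n (s n)

lemma productVec_vecMul_siteOp {N : ℕ} (w : Fin N → Fin 2 → ℂ) (n : Fin N)
    (X : Matrix (Fin 2) (Fin 2) ℂ) :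
    productVec w ᵥ* siteOp n X = productVec (Function.update w n (w n ᵥ* X)) := by
  ext t
  have hprod : ∀ (u : Fin N → Fin 2 → ℂ) (s : Config N),
      productVec u s = u n (s n) * ∏ m ∈ Finset.univ.erase n, u m (s m) := fun u s =>
    (Finset.mul_prod_erase _ _ (Finset.mem_univ n)).symm
  rw [hprod]
  have hrest : ∏ m ∈ Finset.univ.erase n, Function.update w n (w n ᵥ* X) m (t m) =
      ∏ m ∈ Finset.univ.erase n, w m (t m) :=
    Finset.prod_congr rfl fun m hm => by rw [Function.update_of_ne (Finset.ne_of_mem_erase hm)]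
  rw [hrest, Function.update_self]
  simp only [Matrix.vecMul, dotProduct]
  rw [Finset.sum_mul]
  symm
  -- only the configurations that agree with `t` off the site `n` contribute
  refine Fintype.sum_of_injective (fun a : Fin 2 => Function.update t n a)
    (Function.update_injective t n) _ _ (fun s hs => ?_) fun a => ?_
  · rw [siteOp, Matrix.of_apply, if_neg, mul_zero]
    exact fun h => hs ⟨s n, by
      ext m : 1
      by_cases hm : m = n
      · subst hm; simp
      · simp [hm, h m hm]⟩
  · have h2 : ∏ m ∈ Finset.univ.erase n, w m (Function.update t n a m) =
        ∏ m ∈ Finset.univ.erase n, w m (t m) :=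
      Finset.prod_congr rfl fun m hm => by rw [Function.update_of_ne (Finset.ne_of_mem_erase hm)]
    rw [hprod, h2, siteOp, Matrix.of_apply, if_pos fun m hm => Function.update_of_ne hm _ _]
    simp only [Function.update_self]
    ring

lemma productVec_vecMul_list_prod {N : ℕ} (Y : Fin N → Matrix (Fin 2) (Fin 2) ℂ)
    (l : List (Fin N)) (hl : l.Nodup) (w : Fin N → Fin 2 → ℂ) :
    productVec w ᵥ* (l.map fun n => siteOp n (Y n)).prod =
      productVec fun n => if n ∈ l then w n ᵥ* Y n else w n := by
  induction l generalizing w with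
  | nil => simp
  | cons n l ih =>
    obtain ⟨hn, hl⟩ := List.nodup_cons.1 hl
    rw [List.map_cons, List.prod_cons, ← Matrix.vecMul_vecMul, productVec_vecMul_siteOp, ih hl]
    congr 1
    ext m : 1
    by_cases hm : m = n
    · subst hm; simp [hn]
    · simp [hm]

/-- If `w_n` and `w_n X_n` are independent on every site, the co-vectors generated by the one-site
operators `X_n` from the product co-vector `⊗ w_n` are independent: their matrix of components is
the tensor product of the invertible `2 × 2` matrices with rows `w_n X_n` and `w_n`. -/
lemma det_sovMatrix_siteOp_ne_zero {N : ℕ} (X : Fin N → Matrix (Fin 2) (Fin 2) ℂ)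
    (w : Fin N → Fin 2 → ℂ)
    (hw : ∀ n, (Matrix.of fun h : Fin 2 => w n ᵥ* X n ^ (1 - (h : ℕ))).det ≠ 0) :
    (sovMatrix (productVec w) fun n => siteOp n (X n)).det ≠ 0 := by
  set m : Fin N → Matrix (Fin 2) (Fin 2) ℂ :=
    fun n => Matrix.of fun h : Fin 2 => w n ᵥ* X n ^ (1 - (h : ℕ)) with hm
  have hsov : (sovMatrix (productVec w) fun n => siteOp n (X n)) =
      Matrix.of fun h s => ∏ n, m n (h n) (s n) := by
    ext h s
    have hpow : ∀ n, siteOp n (X n) ^ (1 - (h n : ℕ)) = siteOp n (X n ^ (1 - (h n : ℕ))) := by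
      intro n
      obtain h0 | h1 : h n = 0 ∨ h n = 1 := by omega
      · simp [h0]
      · simp [h1, siteOp_one]
    simp only [sovMatrix, Matrix.of_apply, hpow, List.ofFn_eq_map,
      productVec_vecMul_list_prod _ _ (List.nodup_finRange N), List.mem_finRange, if_true]
    rfl
  rw [hsov]
  refine Matrix.det_ne_zero_of_right_inverse
    (B := Matrix.of fun s h => ∏ n, (m n)⁻¹ (s n) (h n)) ?_
  ext h k
  simp only [Matrix.mul_apply, Matrix.of_apply, ← Finset.prod_mul_distrib]
  have key : ∀ n, ∑ a, m n (h n) a * (m n)⁻¹ a (k n) = if h n = k n then 1 else 0 := fun n => by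
    rw [← Matrix.mul_apply, Matrix.mul_nonsing_inv _ (isUnit_iff_ne_zero.2 (hw n)),
      Matrix.one_apply]
  rw [← Fintype.piFinset_univ,
    ← Finset.prod_univ_sum (fun _ => Finset.univ) fun n a => m n (h n) a * (m n)⁻¹ a (k n)]
  simp only [key, Matrix.one_apply, Finset.prod_ite_zero, Finset.prod_const_one, Finset.mem_univ,
    true_imp_iff, funext_iff]

/-- A `2 × 2` matrix that is not a multiple of the identity has a cyclic row vector. -/
lemma exists_cyclic_vector (X : Matrix (Fin 2) (Fin 2) ℂ)
    (hX : X 0 1 ≠ 0 ∨ X 1 0 ≠ 0 ∨ X 0 0 ≠ X 1 1) :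
    ∃ w : Fin 2 → ℂ, (Matrix.of fun h : Fin 2 => w ᵥ* X ^ (1 - (h : ℕ))).det ≠ 0 := by
  have key : ∀ w : Fin 2 → ℂ, (Matrix.of fun h : Fin 2 => w ᵥ* X ^ (1 - (h : ℕ))).det =
      w 0 * w 1 * (X 0 0 - X 1 1) + w 1 ^ 2 * X 1 0 - w 0 ^ 2 * X 0 1 := fun w => by
    simp [Matrix.det_fin_two, Matrix.vecMul, dotProduct, Fin.sum_univ_two]
    ring
  by_cases h01 : X 0 1 = 0
  · by_cases h10 : X 1 0 = 0
    · refine ⟨![1, 1], ?_⟩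
      rw [key]
      simpa [h01, h10, sub_eq_zero] using hX
    · exact ⟨![0, 1], by rw [key]; simpa using h10⟩
  · exact ⟨![1, 0], by rw [key]; simpa using h01⟩

/-! ### The transfer matrix as a polynomial in its parameters -/

/-- The permutation operator of the auxiliary space and the site `n`. -/
def permAux {N : ℕ} (n : Fin N) : AuxOp N :=
  Matrix.of fun i j => siteOp n (Matrix.single j i 1)

lemma R0_eq (η : ℂ) {N : ℕ} (n : Fin N) (lam : ℂ) :
    R0 η n lam = lam • (1 : AuxOp N) + η • permAux n := by
  ext i j : 2
  have h : (Matrix.of fun k l => Rmat η lam (i, k) (j, l)) =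
      (if i = j then lam else 0) • (1 : Matrix (Fin 2) (Fin 2) ℂ) +
        η • Matrix.single j i 1 := by
    ext k l
    fin_cases i <;> fin_cases j <;> fin_cases k <;> fin_cases l <;>
      simp [Rmat, finProdFinEquiv, Matrix.single]
  simp only [R0, permAux, Matrix.of_apply, Matrix.add_apply, Matrix.smul_apply, h, siteOp_add,
    siteOp_smul, siteOp_one, Matrix.one_apply (i := i)]
  split_ifs <;> simp

/-- The embedding of the scalar matrices on the auxiliary space is linear. -/
def onAuxLinear (N : ℕ) : Matrix (Fin 2) (Fin 2) ℂ →ₗ[ℂ] AuxOp N :=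
  LinearMap.mapMatrix (LinearMap.toSpanSingleton ℂ (Op N) 1)

lemma onAuxLinear_apply (N : ℕ) (X : Matrix (Fin 2) (Fin 2) ℂ) : onAuxLinear N X = onAux N X :=
  rfl

lemma transferMatrix_smul (η : ℂ) {N : ℕ} (Kp Km : ℂ → Matrix (Fin 2) (Fin 2) ℂ) (rp rm : ℂ)
    (ξ : Fin N → ℂ) (lam : ℂ) :
    transferMatrix η (fun l => rp • Kp l) (fun l => rm • Km l) ξ lam =
      (rp * rm) • transferMatrix η Kp Km ξ lam := by
  simp only [transferMatrix, ← onAuxLinear_apply, map_smul, smul_mul_assoc, mul_smul_comm,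
    Matrix.trace_smul, smul_smul, mul_comm]

lemma bulkMonodromy_eq (η : ℂ) {N : ℕ} (ξ : Fin N → ℂ) (lam : ℂ) :
    bulkMonodromy η ξ lam =
      ((List.finRange N).reverse.map fun n => R0 η n (lam - (ξ n + η / 2))).prod := by
  rw [bulkMonodromy, List.ofFn_eq_map, List.map_reverse]

section polynomial

variable {σ : Type*} {N : ℕ} {η : ℂ}

lemma bulkMonodromy_mem_polyMap (b : Fin N → σ) {lam : (σ → ℂ) → ℂ} (hlam : lam ∈ polyMap σ ℂ) :
    (fun x => bulkMonodromy η (fun n => x (b n)) (lam x)) ∈ polyMap σ (AuxOp N) := by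
  simp only [bulkMonodromy_eq, R0_eq]
  refine list_prod_mem_polyMap (fun n => ?_) _
  exact add_mem (smul_mem_polyMap (sub_mem hlam (add_mem (coord_mem_polyMap (b n))
    (const_mem_polyMap _))) (const_mem_polyMap _)) (const_mem_polyMap _)

lemma transferMatrix_mem_polyMap (b : Fin N → σ) {Kp Km : (σ → ℂ) → ℂ → Matrix (Fin 2) (Fin 2) ℂ}
    {lam : (σ → ℂ) → ℂ} (hlam : lam ∈ polyMap σ ℂ)
    (hKp : (fun x => Kp x (lam x)) ∈ polyMap σ (Matrix (Fin 2) (Fin 2) ℂ))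
    (hKm : (fun x => Km x (lam x)) ∈ polyMap σ (Matrix (Fin 2) (Fin 2) ℂ)) :
    (fun x => transferMatrix η (Kp x) (Km x) (fun n => x (b n)) (lam x)) ∈ polyMap σ (Op N) := by
  refine linear_comp_mem_polyMap (Matrix.traceLinearMap (Fin 2) ℂ (Op N)) ?_
  refine mul_mem_polyMap (mul_mem_polyMap (mul_mem_polyMap
    (linear_comp_mem_polyMap (onAuxLinear N) hKp) (bulkMonodromy_mem_polyMap b hlam))
    (linear_comp_mem_polyMap (onAuxLinear N) hKm)) ?_
  refine Submodule.smul_mem _ ((-1 : ℂ) ^ N) (x := fun x => onAux N sigmaY *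
    (bulkMonodromy η (fun n => x (b n)) (-lam x)).transpose * onAux N sigmaY) ?_
  refine mul_mem_polyMap (mul_mem_polyMap (const_mem_polyMap _) ?_) (const_mem_polyMap _)
  exact linear_comp_mem_polyMap (Matrix.transposeLinearEquiv (Fin 2) (Fin 2) ℂ (Op N)).toLinearMap
    (bulkMonodromy_mem_polyMap b (neg_mem hlam))

lemma det_sovMatrix_mem_polyMap (a : Config N → σ) {T : Fin N → (σ → ℂ) → Op N}
    (hT : ∀ n, T n ∈ polyMap σ (Op N)) :
    (fun x => (sovMatrix (fun s => x (a s)) fun n => T n x).det) ∈ polyMap σ ℂ := by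
  refine det_mem_polyMap fun h s => ?_
  simp only [sovMatrix, Matrix.of_apply, Matrix.vecMul, dotProduct, List.ofFn_eq_map]
  have hprod := list_prod_mem_polyMap (fun n => pow_mem_polyMap (hT n) (1 - (h n : ℕ)))
    (List.finRange N)
  have hsum := Submodule.sum_mem (polyMap σ ℂ) (t := Finset.univ) fun r _ =>
    mul_mem_polyMap (coord_mem_polyMap (a r))
      (linear_comp_mem_polyMap (Matrix.entryLinearMap ℂ ℂ r s) hprod)
  convert hsum using 1
  ext x
  rw [Finset.sum_apply]
  rfl

end polynomial

/-! ### The transfer matrix for large, well separated inhomogeneities -/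

lemma siteOp_eq_sum {N : ℕ} (n : Fin N) (X : Matrix (Fin 2) (Fin 2) ℂ) :
    siteOp n X = ∑ i, ∑ j, X i j • siteOp n (Matrix.single i j 1) := by
  let L : Matrix (Fin 2) (Fin 2) ℂ →ₗ[ℂ] Op N :=
    { toFun := siteOp n, map_add' := siteOp_add n, map_smul' := siteOp_smul n }
  have h := congrArg L (Matrix.matrix_eq_sum_single X)
  simp only [map_sum] at h
  refine h.trans (Finset.sum_congr rfl fun i _ => Finset.sum_congr rfl fun j _ => ?_)
  rw [show X i j • siteOp n (Matrix.single i j 1) = L (X i j • Matrix.single i j 1) from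
    (siteOp_smul n _ _).symm, Matrix.smul_single, smul_eq_mul, mul_one]

lemma trace_onAux_mul_permAux_sub_one {N : ℕ} (n : Fin N) (A B : Matrix (Fin 2) (Fin 2) ℂ) :
    (onAux N A * (permAux n - 1) * onAux N B).trace =
      siteOp n (B * A - (B * A).trace • (1 : Matrix (Fin 2) (Fin 2) ℂ)) := by
  have h1 : siteOp n (Matrix.single 0 0 1) + siteOp n (Matrix.single 1 1 1) = (1 : Op N) := by
    rw [← siteOp_add, ← siteOp_one n]
    congr 1
    ext i j
    fin_cases i <;> fin_cases j <;> simp [Matrix.single]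
  rw [siteOp_eq_sum]
  simp only [Matrix.trace, Matrix.diag_apply, Matrix.mul_apply, Fin.sum_univ_two, onAux,
    Matrix.map_apply, permAux, Matrix.sub_apply, Matrix.of_apply, Matrix.one_apply_eq,
    Matrix.smul_apply, Matrix.one_apply_ne (zero_ne_one : (0 : Fin 2) ≠ 1),
    Matrix.one_apply_ne (one_ne_zero : (1 : Fin 2) ≠ 0), smul_mul_assoc, mul_smul_comm, one_mul,
    mul_one]
  simp only [← h1]
  module

lemma list_prod_map_reverse_finRange {N : ℕ} (c : Fin N → ℂ) :
    ((List.finRange N).reverse.map c).prod = ∏ m, c m := by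
  rw [List.map_reverse, List.prod_reverse, ← List.ofFn_eq_map, List.prod_ofFn]

lemma tendsto_smul_bulkMonodromy (η : ℂ) {N : ℕ} (y : Fin N → ℂ) (n : Fin N) :
    Tendsto (fun t : ℂ => (∏ m, if m = n then 1 else t) •
        bulkMonodromy η (fun m => y m / t) (y n / t - η / 2)) (𝓝[≠] 0)
      (𝓝 ((∏ m, if m = n then 1 else y n - y m) • η • (permAux n - 1))) := by
  have hlim : ((List.finRange N).reverse.map fun m => (if m = n then (1 : ℂ) else y n - y m) •
      (if m = n then η • (permAux n - 1) else (1 : AuxOp N))).prod =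
      (∏ m, if m = n then 1 else y n - y m) • η • (permAux n - 1) := by
    -- all factors but the one at the site `n` are scalar
    rw [list_prod_map_smul, list_prod_map_reverse_finRange,
      List.prod_map_eq_pow_single n _ fun m hm _ => if_neg hm, if_pos rfl,
      List.count_reverse, List.count_eq_one_of_mem (List.nodup_finRange N)
      (List.mem_finRange n), pow_one]
  simp_rw [bulkMonodromy_eq, ← list_prod_map_reverse_finRange, ← list_prod_map_smul,
    list_prod_map_reverse_finRange]
  rw [← hlim]
  refine tendsto_list_prod _ fun m _ => ?_
  by_cases hm : m = n
  -- at the site `n` the argument of the `R`-matrix is `-η`, whatever `t` is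
  · subst hm
    refine tendsto_const_nhds.congr' ?_
    filter_upwards with t
    simp only [if_true, one_smul, R0_eq]
    module
  · simp only [if_neg hm, R0_eq]
    have hc : Tendsto (fun t : ℂ => (y n - y m - t * η) • (1 : AuxOp N) + (t * η) • permAux m)
        (𝓝[≠] 0) (𝓝 ((y n - y m - 0 * η) • (1 : AuxOp N) + (0 * η) • permAux m)) :=
      Tendsto.mono_left (Continuous.tendsto (by fun_prop) 0) nhdsWithin_le_nhds
    simp only [zero_mul, sub_zero, zero_smul, add_zero] at hc
    refine hc.congr' ?_
    filter_upwards [self_mem_nhdsWithin] with t ht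
    rw [smul_add, smul_smul, smul_smul]
    congr 2
    have ht : t ≠ 0 := ht
    field_simp
    ring

lemma sigmaY_mul_self : sigmaY * sigmaY = 1 := by
  ext i j
  fin_cases i <;> fin_cases j <;> simp [sigmaY]

lemma tendsto_smul_hatMonodromy (η : ℂ) {N : ℕ} (y : Fin N → ℂ) (n : Fin N) :
    Tendsto (fun t : ℂ => t ^ N • hatMonodromy η (fun m => y m / t) (y n / t - η / 2)) (𝓝[≠] 0)
      (𝓝 ((∏ m, (y n + y m)) • 1)) := by
  have hbulk : Tendsto (fun t : ℂ => ((List.finRange N).reverse.map fun m => (-t) •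
      R0 η m (-(y n / t - η / 2) - (y m / t + η / 2))).prod) (𝓝[≠] 0)
      (𝓝 (((List.finRange N).reverse.map fun m => (y n + y m) • (1 : AuxOp N)).prod)) := by
    refine tendsto_list_prod _ fun m _ => ?_
    have hc : Tendsto (fun t : ℂ => (y n + y m) • (1 : AuxOp N) + (-t * η) • permAux m)
        (𝓝[≠] 0) (𝓝 ((y n + y m) • (1 : AuxOp N) + (-0 * η) • permAux m)) :=
      Tendsto.mono_left (Continuous.tendsto (by fun_prop) 0) nhdsWithin_le_nhds
    simp only [neg_zero, zero_mul, zero_smul, add_zero] at hc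
    refine hc.congr' ?_
    filter_upwards [self_mem_nhdsWithin] with t ht
    rw [R0_eq, smul_add, smul_smul, smul_smul]
    congr 2
    have ht : t ≠ 0 := ht
    field_simp
    ring
  rw [list_prod_map_smul, list_prod_map_reverse_finRange, List.prod_map_one] at hbulk
  have hσ : onAux N sigmaY * onAux N sigmaY = 1 := by
    have h : onAux N sigmaY = (Algebra.ofId ℂ (Op N)).mapMatrix sigmaY := by
      ext i j : 2
      simp [onAux, Algebra.ofId_apply, Algebra.algebraMap_eq_smul_one]
    rw [h, ← map_mul, sigmaY_mul_self, map_one]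
  have hcont : Continuous fun X : AuxOp N => onAux N sigmaY * X.transpose * onAux N sigmaY :=
    (continuous_const.mul continuous_id.matrix_transpose).mul continuous_const
  have h := (hcont.tendsto _).comp hbulk
  rw [Matrix.transpose_smul, Matrix.transpose_one, mul_smul_comm, mul_one, smul_mul_assoc, hσ] at h
  refine h.congr fun t => ?_
  simp only [Function.comp_apply, list_prod_map_smul, list_prod_map_reverse_finRange,
    ← bulkMonodromy_eq, hatMonodromy, Matrix.transpose_smul, mul_smul_comm, smul_mul_assoc,
    smul_smul, Finset.prod_const, Finset.card_univ, Fintype.card_fin]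
  rw [← mul_pow, mul_neg_one]

lemma tendsto_smul_transferMatrix (η : ℂ) {N : ℕ} (y : Fin N → ℂ) (n : Fin N) {cp cm : ℂ → ℂ}
    {Kp Km : ℂ → ℂ → Matrix (Fin 2) (Fin 2) ℂ} {Lp Lm : Matrix (Fin 2) (Fin 2) ℂ}
    (hp : Tendsto (fun t => cp t • Kp t (y n / t - η / 2)) (𝓝[≠] 0) (𝓝 Lp))
    (hm : Tendsto (fun t => cm t • Km t (y n / t - η / 2)) (𝓝[≠] 0) (𝓝 Lm)) :
    Tendsto (fun t : ℂ => (cp t * (∏ m, if m = n then 1 else t) * cm t * t ^ N) •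
        transferMatrix η (Kp t) (Km t) (fun m => y m / t) (y n / t - η / 2)) (𝓝[≠] 0)
      (𝓝 (siteOp n (((∏ m, if m = n then 1 else y n - y m) * η * ∏ m, (y n + y m)) •
        (Lm * Lp - (Lm * Lp).trace • (1 : Matrix (Fin 2) (Fin 2) ℂ))))) := by
  have hcont : Continuous (onAux N) := continuous_id.matrix_map (by fun_prop)
  have htr : Continuous fun X : AuxOp N => X.trace := by fun_prop
  have h := (htr.tendsto _).comp ((((((hcont.tendsto _).comp hp).mul
    (tendsto_smul_bulkMonodromy η y n)).mul ((hcont.tendsto _).comp hm)).mul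
    (tendsto_smul_hatMonodromy η y n)))
  rw [siteOp_smul, ← trace_onAux_mul_permAux_sub_one]
  convert h using 2
  · refine funext fun t => ?_
    simp only [Function.comp_apply, ← onAuxLinear_apply, map_smul, smul_mul_assoc, mul_smul_comm,
      Matrix.trace_smul, smul_smul, transferMatrix]
    ring_nf
  · simp only [smul_mul_assoc, mul_smul_comm, Matrix.trace_smul, smul_smul, mul_one]
    rw [mul_comm (∏ m, (y n + y m))]

lemma continuous_det_sovMatrix {N : ℕ} (v : Config N → ℂ) :
    Continuous fun T : Fin N → Op N => (sovMatrix v T).det := by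
  refine Continuous.matrix_det (continuous_pi fun h => ?_)
  refine Continuous.matrix_vecMul continuous_const ?_
  simp only [List.ofFn_eq_map]
  exact continuous_list_prod _ fun n _ => (continuous_apply n).pow _

/-- If the rescaled boundary matrices have limits `L_±(y)` at `λ = y / t - η / 2` as `t → 0`, and
`L_-(y) L_+(y)` is not a multiple of the identity, then the separated co-vectors are independent
for some choice of `t`, of the co-vector and of the inhomogeneities. -/
lemma exists_det_sovMatrix_ne_zero {η : ℂ} (hη : η ≠ 0) (N : ℕ) {cp cm : ℂ → ℂ}
    {Kp Km : ℂ → ℂ → Matrix (Fin 2) (Fin 2) ℂ} {Lp Lm : ℂ → Matrix (Fin 2) (Fin 2) ℂ}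
    (hp : ∀ y, Tendsto (fun t => cp t • Kp t (y / t - η / 2)) (𝓝[≠] 0) (𝓝 (Lp y)))
    (hm : ∀ y, Tendsto (fun t => cm t • Km t (y / t - η / 2)) (𝓝[≠] 0) (𝓝 (Lm y)))
    (hL : ∀ y, y ≠ 0 → (Lm y * Lp y) 0 1 ≠ 0 ∨ (Lm y * Lp y) 1 0 ≠ 0 ∨
      (Lm y * Lp y) 0 0 ≠ (Lm y * Lp y) 1 1) :
    ∃ (t : ℂ) (v : Config N → ℂ) (ξ : Fin N → ℂ),
      (sovMatrix v fun n => transferMatrix η (Kp t) (Km t) ξ (ξ n - η / 2)).det ≠ 0 := by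
  -- any `y` with `y_n ≠ 0`, `y_n ≠ y_m` and `y_n ≠ -y_m` would do
  set y : Fin N → ℂ := fun n => ((n : ℕ) + 1 : ℕ) with hy
  have hy0 : ∀ n, y n ≠ 0 := fun n => Nat.cast_ne_zero.2 (Nat.succ_ne_zero _)
  have hadd : ∀ n m, y n + y m ≠ 0 := fun n m => by
    simp only [hy, ← Nat.cast_add]
    exact Nat.cast_ne_zero.2 (by omega)
  have hsub : ∀ n m, m ≠ n → y n - y m ≠ 0 := fun n m hmn h => hmn <| by
    have := Nat.cast_injective (R := ℂ) (sub_eq_zero.1 h)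
    exact Fin.ext (by omega)
  set c : Fin N → ℂ := fun n => (∏ m, if m = n then 1 else y n - y m) * η * ∏ m, (y n + y m)
  have hc : ∀ n, c n ≠ 0 := fun n => by
    refine mul_ne_zero (mul_ne_zero (Finset.prod_ne_zero_iff.2 fun m _ => ?_) hη)
      (Finset.prod_ne_zero_iff.2 fun m _ => hadd n m)
    split_ifs with h
    · exact one_ne_zero
    · exact hsub n m h
  set X : Fin N → Matrix (Fin 2) (Fin 2) ℂ := fun n => c n •
    (Lm (y n) * Lp (y n) - (Lm (y n) * Lp (y n)).trace • (1 : Matrix (Fin 2) (Fin 2) ℂ))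
  have hX : ∀ n, X n 0 1 ≠ 0 ∨ X n 1 0 ≠ 0 ∨ X n 0 0 ≠ X n 1 1 := fun n => by
    simpa [X, hc n] using hL (y n) (hy0 n)
  choose w hw using fun n => exists_cyclic_vector (X n) (hX n)
  have hlim := ((continuous_det_sovMatrix (productVec w)).tendsto _).comp
    (tendsto_pi_nhds.2 fun n => tendsto_smul_transferMatrix η y n (hp (y n)) (hm (y n)))
  obtain ⟨t, ht⟩ := (hlim.eventually_ne (det_sovMatrix_siteOp_ne_zero X w hw)).exists
  refine ⟨t, productVec w, fun m => y m / t, ?_⟩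
  simp only [Function.comp_apply, det_sovMatrix_smul] at ht
  exact right_ne_zero_of_mul ht

/-! ### Boundary matrices -/

/-- The coefficient of `λ - η/2` in `ζ K(λ; ζ, κ, τ)`. -/
def boundarySlope (κ τ : ℂ) : Matrix (Fin 2) (Fin 2) ℂ :=
  !![1, 2 * κ * Complex.exp τ; 2 * κ * Complex.exp (-τ), -1]

/-- The boundary matrix with its denominator cleared: `ζ K(λ; ζ, κ, τ)` for finite `ζ`, and the
identity for `ζ = ∞`. -/
def boundaryNumerator (η : ℂ) (ζ : OnePoint ℂ) (κ τ lam : ℂ) : Matrix (Fin 2) (Fin 2) ℂ :=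
  ζ.elim 1 fun z => z • 1 + (lam - η / 2) • boundarySlope κ τ

lemma boundaryNumerator_infty (η κ τ lam : ℂ) : boundaryNumerator η ∞ κ τ lam = 1 := rfl

lemma boundaryNumerator_coe (η z κ τ lam : ℂ) :
    boundaryNumerator η z κ τ lam = z • 1 + (lam - η / 2) • boundarySlope κ τ := rfl

lemma Kmat_coe (η z κ τ lam : ℂ) :
    Kmat η z κ τ lam = (1 / z) • boundaryNumerator η z κ τ lam := by
  change (1 / z) • _ = _
  congr 1
  ext i j
  fin_cases i <;> fin_cases j <;> simp [boundaryNumerator_coe, boundarySlope] <;> ring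

lemma exists_Kmat_eq_smul (η : ℂ) {ζ : OnePoint ℂ} (hζ : ζ ≠ ((0 : ℂ) : OnePoint ℂ)) (κ τ : ℂ) :
    ∃ r : ℂ, r ≠ 0 ∧ ∀ lam, Kmat η ζ κ τ lam = r • boundaryNumerator η ζ κ τ lam := by
  induction ζ using OnePoint.rec with
  | infty => exact ⟨1, one_ne_zero, fun lam => (one_smul _ _).symm⟩
  | coe z =>
    exact ⟨1 / z, one_div_ne_zero fun h => hζ (by rw [h]), Kmat_coe η z κ τ⟩

lemma boundaryNumerator_const_mem_polyMap {σ : Type*} (η : ℂ) (ζ : OnePoint ℂ) (κ τ : ℂ)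
    {lam : (σ → ℂ) → ℂ} (hlam : lam ∈ polyMap σ ℂ) :
    (fun x => boundaryNumerator η ζ κ τ (lam x)) ∈ polyMap σ (Matrix (Fin 2) (Fin 2) ℂ) := by
  induction ζ using OnePoint.rec with
  | infty => exact const_mem_polyMap _
  | coe z =>
    exact add_mem (const_mem_polyMap _)
      (smul_mem_polyMap (sub_mem hlam (const_mem_polyMap _)) (const_mem_polyMap _))

lemma boundaryNumerator_coord_mem_polyMap {σ : Type*} (η : ℂ) (i : σ) (κ τ : ℂ)
    {lam : (σ → ℂ) → ℂ} (hlam : lam ∈ polyMap σ ℂ) :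
    (fun x => boundaryNumerator η (x i : OnePoint ℂ) κ τ (lam x)) ∈
      polyMap σ (Matrix (Fin 2) (Fin 2) ℂ) :=
  add_mem (smul_mem_polyMap (coord_mem_polyMap i) (const_mem_polyMap _))
    (smul_mem_polyMap (sub_mem hlam (const_mem_polyMap _)) (const_mem_polyMap _))

lemma tendsto_smul_boundaryNumerator_coe (η z κ τ s y : ℂ) :
    Tendsto (fun t : ℂ => t • boundaryNumerator η z κ τ (y / t - η / 2 + s)) (𝓝[≠] 0)
      (𝓝 (y • boundarySlope κ τ)) := by
  have hc : Tendsto (fun t : ℂ => (t * z) • (1 : Matrix (Fin 2) (Fin 2) ℂ) +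
      (y + t * (s - η)) • boundarySlope κ τ) (𝓝[≠] 0)
      (𝓝 ((0 * z) • (1 : Matrix (Fin 2) (Fin 2) ℂ) + (y + 0 * (s - η)) • boundarySlope κ τ)) :=
    Tendsto.mono_left (Continuous.tendsto (by fun_prop) 0) nhdsWithin_le_nhds
  simp only [zero_mul, zero_smul, zero_add, add_zero] at hc
  refine hc.congr' ?_
  filter_upwards [self_mem_nhdsWithin] with t ht
  have ht : t ≠ 0 := ht
  rw [boundaryNumerator_coe, smul_add, smul_smul, smul_smul]
  congr 2
  field_simp
  ring

/-- Letting the boundary parameter grow with the spectral parameter keeps the scalar part of the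
boundary matrix in the limit. -/
lemma tendsto_smul_boundaryNumerator_inv (η κ τ s y : ℂ) :
    Tendsto (fun t : ℂ => t • boundaryNumerator η (t⁻¹ : ℂ) κ τ (y / t - η / 2 + s)) (𝓝[≠] 0)
      (𝓝 (1 + y • boundarySlope κ τ)) := by
  have hc := (tendsto_smul_boundaryNumerator_coe η 0 κ τ s y).const_add 1
  refine hc.congr' ?_
  filter_upwards [self_mem_nhdsWithin] with t ht
  have ht : t ≠ 0 := ht
  rw [boundaryNumerator_coe, boundaryNumerator_coe, zero_smul, zero_add, smul_add,
    smul_inv_smul₀ ht]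

lemma exists_tendsto_smul_boundaryNumerator (η : ℂ) (ζ : OnePoint ℂ) (κ τ s : ℂ) :
    ∃ (c : ℂ → ℂ) (L : ℂ → Matrix (Fin 2) (Fin 2) ℂ),
      (∀ y, Tendsto (fun t : ℂ => c t • boundaryNumerator η ζ κ τ (y / t - η / 2 + s)) (𝓝[≠] 0)
        (𝓝 (L y))) ∧ ((∀ y, L y = 1) ∨ ∀ y, L y = y • boundarySlope κ τ) := by
  induction ζ using OnePoint.rec with
  | infty =>
    refine ⟨fun _ => 1, fun _ => 1, fun y => ?_, Or.inl fun _ => rfl⟩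
    simpa only [boundaryNumerator_infty, one_smul] using tendsto_const_nhds
  | coe z =>
    exact ⟨fun t => t, fun y => y • boundarySlope κ τ,
      tendsto_smul_boundaryNumerator_coe η z κ τ s, Or.inr fun _ => rfl⟩

lemma boundarySlope_mul_self (κ τ : ℂ) :
    boundarySlope κ τ * boundarySlope κ τ = (1 + 4 * κ ^ 2) • 1 := by
  have h : Complex.exp τ * Complex.exp (-τ) = 1 := by rw [← Complex.exp_add]; simp
  ext i j
  fin_cases i <;> fin_cases j <;> simp [boundarySlope]
  · linear_combination 4 * κ ^ 2 * h
  · linear_combination 4 * κ ^ 2 * h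

/-- Both orders of the product are covered, since the slope commutes with itself. -/
lemma one_add_smul_boundarySlope_mul_diag_ne {κ τ y : ℂ} (hy : y ≠ 0)
    {L : Matrix (Fin 2) (Fin 2) ℂ} (hL : L = 1 ∨ L = y • boundarySlope κ τ) :
    ((1 + y • boundarySlope κ τ) * L) 0 0 ≠ ((1 + y • boundarySlope κ τ) * L) 1 1 ∧
      (L * (1 + y • boundarySlope κ τ)) 0 0 ≠ (L * (1 + y • boundarySlope κ τ)) 1 1 := by
  have h2 : y ≠ -y := fun h => hy (self_eq_neg.1 h)
  rcases hL with rfl | rfl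
  · simpa [boundarySlope] using h2
  · have h := boundarySlope_mul_self κ τ
    simp only [add_mul, mul_add, one_mul, mul_one, smul_mul_smul_comm, h]
    simpa [boundarySlope] using h2

lemma boundarySlope_mul_offDiag_ne {κp τp κm τm : ℂ}
    (h : κm * Complex.exp τm ≠ κp * Complex.exp τp ∨
      κm * Complex.exp (-τm) ≠ κp * Complex.exp (-τp)) {y : ℂ} (hy : y ≠ 0) :
    ((y • boundarySlope κm τm) * (y • boundarySlope κp τp)) 0 1 ≠ 0 ∨
      ((y • boundarySlope κm τm) * (y • boundarySlope κp τp)) 1 0 ≠ 0 := by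
  refine h.imp (fun h h0 => h ?_) fun h h0 => h ?_
  · simp [boundarySlope, Matrix.mul_apply, Fin.sum_univ_two] at h0
    exact mul_left_cancel₀ (pow_ne_zero 2 hy) (by linear_combination (-1 / 2 : ℂ) * h0)
  · simp [boundarySlope, Matrix.mul_apply, Fin.sum_univ_two] at h0
    exact mul_left_cancel₀ (pow_ne_zero 2 hy) (by linear_combination (1 / 2 : ℂ) * h0)

lemma boundarySlope_congr {κp τp κm τm : ℂ} (h : κm * Complex.exp τm = κp * Complex.exp τp)
    (h' : κm * Complex.exp (-τm) = κp * Complex.exp (-τp)) :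
    boundarySlope κm τm = boundarySlope κp τp := by
  simp only [boundarySlope, mul_assoc, h, h']

/-! ### The normalizing coefficient at generic points -/

lemma exists_zetaBar_eq {ε : ℂ} (hε : ε = 1 ∨ ε = -1) (κ : ℂ) :
    ∃ c : ℂ, c ≠ 0 ∧ ∀ z : ℂ, zetaBar ε κ (z : OnePoint ℂ) = ((c * z : ℂ) : OnePoint ℂ) := by
  have hε0 : ε ≠ 0 := by rcases hε with rfl | rfl <;> simp
  by_cases h : κ ^ 2 = -1 / 4
  · exact ⟨1, one_ne_zero, fun z => by simp [zetaBar, h]⟩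
  · refine ⟨ε / (1 + 4 * κ ^ 2) ^ (1 / 2 : ℂ), div_ne_zero hε0 ?_, fun z => ?_⟩
    · rw [Ne, Complex.cpow_eq_zero_iff, not_and_or]
      exact Or.inl fun h0 => h (by linear_combination h0 / 4)
    · simp only [zetaBar, OnePoint.map_some, if_neg h]
      congr 1
      ring

lemma boundaryFactor_coe_ne_zero {η z ξ : ℂ} (hz : z ≠ 0) (h : z - ξ ≠ 0) :
    boundaryFactor η (z : OnePoint ℂ) (η / 2 - ξ) ≠ 0 := by
  refine div_ne_zero ?_ hz
  rwa [sub_right_comm, sub_self, zero_sub, neg_add_eq_sub]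

lemma eventually_boundaryFactor_const_ne_zero {σ : Type*} (η : ℂ) {ε : ℂ} (hε : ε = 1 ∨ ε = -1)
    (κ : ℂ) {ζ : OnePoint ℂ} (hζ : ζ ≠ ((0 : ℂ) : OnePoint ℂ)) (j : σ) :
    ∀ᶠ x in generic σ, boundaryFactor η (zetaBar ε κ ζ) (η / 2 - x j) ≠ 0 := by
  induction ζ using OnePoint.rec with
  | infty => exact Eventually.of_forall fun x => one_ne_zero
  | coe z =>
    obtain ⟨c, hc, hcz⟩ := exists_zetaBar_eq hε κ
    have hz : c * z ≠ 0 := mul_ne_zero hc fun h => hζ (by rw [h])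
    filter_upwards [eventually_ne_zero_of_mem_polyMap (f := fun x : σ → ℂ => c * z - x j)
      (sub_mem (const_mem_polyMap _) (coord_mem_polyMap j)) 0 (by simpa using hz)] with x hx
    rw [hcz]
    exact boundaryFactor_coe_ne_zero hz hx

lemma eventually_boundaryFactor_coord_ne_zero {σ : Type*} (η : ℂ) {ε : ℂ} (hε : ε = 1 ∨ ε = -1)
    (κ : ℂ) {i j : σ} (hij : i ≠ j) :
    ∀ᶠ x in generic σ,
      boundaryFactor η (zetaBar ε κ (x i : OnePoint ℂ)) (η / 2 - x j) ≠ 0 := by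
  classical
  obtain ⟨c, hc, hcz⟩ := exists_zetaBar_eq hε κ
  filter_upwards [eventually_ne_zero_of_mem_polyMap (coord_mem_polyMap i) 1 one_ne_zero,
    eventually_ne_zero_of_mem_polyMap (f := fun x : σ → ℂ => c * x i - x j)
      (sub_mem (mul_mem_polyMap (const_mem_polyMap _) (coord_mem_polyMap i))
        (coord_mem_polyMap j)) (Pi.single i 1) (by simpa [hij.symm] using hc)] with x hi hx
  rw [hcz]
  exact boundaryFactor_coe_ne_zero (mul_ne_zero hc hi) hx

lemma eventually_Acoef_ne_zero {σ : Type*} {η : ℂ} (hη : η ≠ 0) {N : ℕ} (b : Fin N → σ) (n : Fin N)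
    {ζbp ζbm : (σ → ℂ) → OnePoint ℂ}
    (hp : ∀ᶠ x in generic σ, boundaryFactor η (ζbp x) (η / 2 - x (b n)) ≠ 0)
    (hm : ∀ᶠ x in generic σ, boundaryFactor η (ζbm x) (η / 2 - x (b n)) ≠ 0) :
    ∀ᶠ x in generic σ,
      Acoef η (ζbp x) (ζbm x) (fun m => x (b m)) (η / 2 - x (b n)) ≠ 0 := by
  have hX := fun m => coord_mem_polyMap (b m)
  have h1 := eventually_ne_zero_of_mem_polyMap (f := fun x => η - x (b n))
    (sub_mem (const_mem_polyMap _) (hX n)) 0 (by simpa using hη)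
  have h2 := eventually_ne_zero_of_mem_polyMap (f := fun x => η - (x (b n) + x (b n)))
    (sub_mem (const_mem_polyMap _) (add_mem (hX n) (hX n))) 0 (by simpa using hη)
  have h3 := eventually_all.2 fun m => eventually_ne_zero_of_mem_polyMap
    (f := fun x => η - (x (b n) + x (b m)))
    (sub_mem (const_mem_polyMap _) (add_mem (hX n) (hX m))) 0 (by simpa using hη)
  have h4 := eventually_all.2 fun m => eventually_ne_zero_of_mem_polyMap
    (f := fun x => x (b n) - x (b m) - η)
    (sub_mem (sub_mem (hX n) (hX m)) (const_mem_polyMap _)) 0 (by simpa using hη)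
  filter_upwards [hp, hm, h1, h2, h3, h4] with x hp hm h1 h2 h3 h4
  refine mul_ne_zero (mul_ne_zero (mul_ne_zero (mul_ne_zero (pow_ne_zero _ (by simp))
    (div_ne_zero ?_ ?_)) (mul_ne_zero hp hm)) (Finset.prod_ne_zero_iff.2 fun m _ => ?_))
    (Finset.prod_ne_zero_iff.2 fun m _ => ?_)
  · exact fun h => h1 (by linear_combination h / 2)
  · exact fun h => h2 (by linear_combination h)
  · exact fun h => h3 m (by linear_combination h)
  · exact fun h => h4 m (by linear_combination h)

/-! ### Separated bases at generic points -/

/-- Independence of the separated co-vectors at a single point yields the basis property at generic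
points, whichever of the parameters are taken as coordinates of the point. -/
lemma eventually_sovIsBasis {σ : Type*} {η : ℂ} (hη : η ≠ 0) {N : ℕ} (a : Config N → σ)
    (b : Fin N → σ) {εp εm κp τp κm τm : ℂ} {ζp ζm : (σ → ℂ) → OnePoint ℂ}
    (hKp : ∀ lam ∈ polyMap σ ℂ, (fun x => boundaryNumerator η (ζp x) κp τp (lam x)) ∈
      polyMap σ (Matrix (Fin 2) (Fin 2) ℂ))
    (hKm : ∀ lam ∈ polyMap σ ℂ, (fun x => boundaryNumerator η (ζm x) κm τm (lam x)) ∈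
      polyMap σ (Matrix (Fin 2) (Fin 2) ℂ))
    (hFp : ∀ n, ∀ᶠ x in generic σ,
      boundaryFactor η (zetaBar εp κp (ζp x)) (η / 2 - x (b n)) ≠ 0)
    (hFm : ∀ n, ∀ᶠ x in generic σ,
      boundaryFactor η (zetaBar εm κm (ζm x)) (η / 2 - x (b n)) ≠ 0)
    (x₀ : σ → ℂ)
    (hx₀ : (sovMatrix (fun s => x₀ (a s)) fun n =>
      transferMatrix η (fun l => boundaryNumerator η (ζp x₀) κp τp (l + η))
        (fun l => boundaryNumerator η (ζm x₀) κm τm l) (fun m => x₀ (b m))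
        (x₀ (b n) - η / 2)).det ≠ 0) :
    ∀ᶠ x in generic σ, ζp x ≠ ((0 : ℂ) : OnePoint ℂ) → ζm x ≠ ((0 : ℂ) : OnePoint ℂ) →
      ∀ S : Module.Dual ℂ (QSpace N), (coords S = fun s => x (a s)) →
        SovIsBasis η εp εm (ζp x) (ζm x) κp τp κm τm S fun n => x (b n) := by
  have hlam : ∀ n, (fun x => x (b n) - η / 2) ∈ polyMap σ ℂ := fun n =>
    sub_mem (coord_mem_polyMap (b n)) (const_mem_polyMap _)
  have hpoly := det_sovMatrix_mem_polyMap a (T := fun n x =>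
      transferMatrix η (fun l => boundaryNumerator η (ζp x) κp τp (l + η))
        (fun l => boundaryNumerator η (ζm x) κm τm l) (fun m => x (b m)) (x (b n) - η / 2))
    fun n => transferMatrix_mem_polyMap b
      (Kp := fun x l => boundaryNumerator η (ζp x) κp τp (l + η))
      (Km := fun x l => boundaryNumerator η (ζm x) κm τm l) (hlam n)
      (hKp _ (add_mem (hlam n) (const_mem_polyMap η))) (hKm _ (hlam n))
  filter_upwards [eventually_ne_zero_of_mem_polyMap hpoly x₀ hx₀,
    eventually_all.2 fun n => eventually_Acoef_ne_zero hη b n (hFp n) (hFm n)] with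
    x hdet hA hp hm S hS
  refine sovIsBasis_of_det_ne_zero hA ?_
  obtain ⟨rp, hrp, hKp'⟩ := exists_Kmat_eq_smul η hp κp τp
  obtain ⟨rm, hrm, hKm'⟩ := exists_Kmat_eq_smul η hm κm τm
  have hp' : Kplus η (ζp x) κp τp = fun l => rp • boundaryNumerator η (ζp x) κp τp (l + η) :=
    funext fun l => hKp' (l + η)
  have hm' : Kminus η (ζm x) κm τm = fun l => rm • boundaryNumerator η (ζm x) κm τm l :=
    funext fun l => hKm' l
  simp only [hp', hm', transferMatrix_smul, det_sovMatrix_smul, hS]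
  exact mul_ne_zero (Finset.prod_ne_zero_iff.2 fun h _ => Finset.prod_ne_zero_iff.2 fun n _ =>
    pow_ne_zero _ (mul_ne_zero hrp hrm)) hdet

end ReflAlg

end

theorem theorem2p1 (N : ℕ) (η : ℂ) (hη : η ≠ 0) (κp τp κm τm : ℂ)
    (εp εm : ℂ) (hεp : εp = 1 ∨ εp = -1) (hεm : εm = 1 ∨ εm = -1) :
    -- non-commuting boundary matrices
    ((κm * Complex.exp τm ≠ κp * Complex.exp τp ∨
        κm * Complex.exp (-τm) ≠ κp * Complex.exp (-τp)) →
      ∀ ζp ζm : ℂ, ζp ≠ 0 → ζm ≠ 0 →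
        ReflAlg.ForAlmostAll fun (S : Module.Dual ℂ (ReflAlg.QSpace N)) ξ =>
          ReflAlg.Admissible η ξ →
            ReflAlg.SovIsBasis η εp εm (ζp : OnePoint ℂ) (ζm : OnePoint ℂ) κp τp κm τm S ξ) ∧
    -- commuting boundary matrices; the fixed one may be the identity, the other one is not
    ((κm * Complex.exp τm = κp * Complex.exp τp ∧
        κm * Complex.exp (-τm) = κp * Complex.exp (-τp)) →
      (∀ ζp : OnePoint ℂ, ζp ≠ ((0 : ℂ) : OnePoint ℂ) →
        ReflAlg.ForAlmostAll₃ fun (S : Module.Dual ℂ (ReflAlg.QSpace N)) ξ (ζm : ℂ) =>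
          ReflAlg.Admissible η ξ → ζm ≠ 0 →
            ReflAlg.SovIsBasis η εp εm ζp (ζm : OnePoint ℂ) κp τp κm τm S ξ) ∧
      (∀ ζm : OnePoint ℂ, ζm ≠ ((0 : ℂ) : OnePoint ℂ) →
        ReflAlg.ForAlmostAll₃ fun (S : Module.Dual ℂ (ReflAlg.QSpace N)) ξ (ζp : ℂ) =>
          ReflAlg.Admissible η ξ → ζp ≠ 0 →
            ReflAlg.SovIsBasis η εp εm (ζp : OnePoint ℂ) ζm κp τp κm τm S ξ)) := by
  have hcoe : ∀ z : ℂ, z ≠ 0 → (z : OnePoint ℂ) ≠ ((0 : ℂ) : OnePoint ℂ) := fun z hz h =>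
    hz (OnePoint.coe_injective h)
  refine ⟨fun hK ζp ζm hζp hζm => ?_, fun hK => ⟨fun ζp hζp => ?_, fun ζm hζm => ?_⟩⟩
  · obtain ⟨t, v, ξ, hdet⟩ := ReflAlg.exists_det_sovMatrix_ne_zero hη N
      (cp := fun t => t) (cm := fun t => t)
      (Kp := fun _ l => ReflAlg.boundaryNumerator η ζp κp τp (l + η))
      (Km := fun _ l => ReflAlg.boundaryNumerator η ζm κm τm l)
      (ReflAlg.tendsto_smul_boundaryNumerator_coe η ζp κp τp η)
      (by simpa only [add_zero] using ReflAlg.tendsto_smul_boundaryNumerator_coe η ζm κm τm 0)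
      fun y hy => (ReflAlg.boundarySlope_mul_offDiag_ne hK hy).imp_right Or.inl
    obtain ⟨P, hP, hbasis⟩ := ReflAlg.eventually_generic.1
      (ReflAlg.eventually_sovIsBasis hη (σ := ReflAlg.Config N ⊕ Fin N) Sum.inl Sum.inr
        (ζp := fun _ => ζp) (ζm := fun _ => ζm)
        (fun lam h => ReflAlg.boundaryNumerator_const_mem_polyMap η ζp κp τp h)
        (fun lam h => ReflAlg.boundaryNumerator_const_mem_polyMap η ζm κm τm h)
        (fun n => ReflAlg.eventually_boundaryFactor_const_ne_zero η hεp κp (hcoe ζp hζp) _)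
        (fun n => ReflAlg.eventually_boundaryFactor_const_ne_zero η hεm κm (hcoe ζm hζm) _)
        (Sum.elim v ξ) hdet)
    exact ⟨P, hP, fun S ξ hPx _ => hbasis _ hPx (hcoe ζp hζp) (hcoe ζm hζm) S rfl⟩
  · obtain ⟨c, L, hL, hL'⟩ := ReflAlg.exists_tendsto_smul_boundaryNumerator η ζp κp τp η
    obtain ⟨t, v, ξ, hdet⟩ := ReflAlg.exists_det_sovMatrix_ne_zero hη N (cm := fun t => t)
      (Kp := fun _ l => ReflAlg.boundaryNumerator η ζp κp τp (l + η))
      (Km := fun t l => ReflAlg.boundaryNumerator η (t⁻¹ : ℂ) κm τm l) hL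
      (by simpa only [add_zero] using ReflAlg.tendsto_smul_boundaryNumerator_inv η κm τm 0)
      fun y hy => by
        rw [ReflAlg.boundarySlope_congr hK.1 hK.2]
        exact Or.inr (Or.inr (ReflAlg.one_add_smul_boundarySlope_mul_diag_ne hy
          (hL'.imp (fun h => h y) fun h => h y)).1)
    obtain ⟨P, hP, hbasis⟩ := ReflAlg.eventually_generic.1
      (ReflAlg.eventually_sovIsBasis hη (σ := ReflAlg.Config N ⊕ Fin N ⊕ Unit) Sum.inl
        (fun n => Sum.inr (Sum.inl n))
        (ζp := fun _ => ζp) (ζm := fun x => (x (Sum.inr (Sum.inr ())) : OnePoint ℂ))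
        (fun lam h => ReflAlg.boundaryNumerator_const_mem_polyMap η ζp κp τp h)
        (fun lam h => ReflAlg.boundaryNumerator_coord_mem_polyMap η _ κm τm h)
        (fun n => ReflAlg.eventually_boundaryFactor_const_ne_zero η hεp κp hζp _)
        (fun n => ReflAlg.eventually_boundaryFactor_coord_ne_zero η hεm κm (by simp))
        (Sum.elim v (Sum.elim ξ fun _ => t⁻¹)) hdet)
    exact ⟨P, hP, fun S ξ ζm hPx _ hζm => hbasis _ hPx hζp (hcoe ζm hζm) S rfl⟩
  · obtain ⟨c, L, hL, hL'⟩ := ReflAlg.exists_tendsto_smul_boundaryNumerator η ζm κm τm 0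
    obtain ⟨t, v, ξ, hdet⟩ := ReflAlg.exists_det_sovMatrix_ne_zero hη N (cp := fun t => t)
      (Kp := fun t l => ReflAlg.boundaryNumerator η (t⁻¹ : ℂ) κp τp (l + η))
      (Km := fun _ l => ReflAlg.boundaryNumerator η ζm κm τm l)
      (ReflAlg.tendsto_smul_boundaryNumerator_inv η κp τp η)
      (by simpa only [add_zero] using hL)
      fun y hy => by
        rw [← ReflAlg.boundarySlope_congr hK.1 hK.2]
        exact Or.inr (Or.inr (ReflAlg.one_add_smul_boundarySlope_mul_diag_ne hy
          (hL'.imp (fun h => h y) fun h => h y)).2)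
    obtain ⟨P, hP, hbasis⟩ := ReflAlg.eventually_generic.1
      (ReflAlg.eventually_sovIsBasis hη (σ := ReflAlg.Config N ⊕ Fin N ⊕ Unit) Sum.inl
        (fun n => Sum.inr (Sum.inl n))
        (ζp := fun x => (x (Sum.inr (Sum.inr ())) : OnePoint ℂ)) (ζm := fun _ => ζm)
        (fun lam h => ReflAlg.boundaryNumerator_coord_mem_polyMap η _ κp τp h)
        (fun lam h => ReflAlg.boundaryNumerator_const_mem_polyMap η ζm κm τm h)
        (fun n => ReflAlg.eventually_boundaryFactor_coord_ne_zero η hεp κp (by simp))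
        (fun n => ReflAlg.eventually_boundaryFactor_const_ne_zero η hεm κm hζm _)
        (Sum.elim v (Sum.elim ξ fun _ => t⁻¹)) hdet)
    exact ⟨P, hP, fun S ξ ζp hPx _ hζp => hbasis _ hPx (hcoe ζp hζp) hζm S rfl⟩
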